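/- Let $n\ge 1$ and $0\le m\le n$ be integers, let $\tau>0$, let $a_0,\dots,a_{n-1},\alpha_0,\dots,\alpha_m\in\mathbb R$, and define $\Delta:\mathbb C\to\mathbb C$ by $$\Delta(s)=s^n+\sum_{k=0}^{n-1}a_ks^k+e^{-s\tau}\sum_{k=0}^{m}\alpha_ks^k .$$ Let $s_0\in\mathbb R$ and assume that $$a_k=\binom nk(-s_0)^{n-k}+(-1)^{n-k}\,n!\sum_{j=k}^{n-1}\frac{\binom jk\binom{m+n-j}{m}s_0^{\,j-k}}{j!\,\tau^{n-j}}\qquad(0\le k\le n-1),$$ $$\alpha_k=(-1)^{n-1}e^{s_0\tau}\sum_{j=k}^{m}\frac{(-1)^{j-k}(m+n-j)!\,s_0^{\,j-k}}{k!\,(j-k)!\,(m-j)!\,\tau^{n-j}}\qquad(0\le k\le m).$$ 1. (Retarded case.) If $m<n$, then $s_0$ is a strictly dominant root of $\Delta$: $\Delta(s_0)=0$, and every root $s\ne s_0$ of $\Delta$ in $\mathbb C$ satisfies $\operatorname{Re}s<s_0$. 2. (Neutral case.) If $m=n$, then $s_0$ is a dominant root of $\Delta$ (that is, $\Delta(s_0)=0$,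 and every root $s\neq s_0$ of $\Delta$ in $\mathbb C$ satisfies $\operatorname{Re}s\le s_0$), and in fact every root $s\in\mathbb C$ of $\Delta$ satisfies $\operatorname{Re}s=s_0$. More precisely, the set of roots of $\Delta$ is $\{\,s_0+i\,\zeta/\tau : \zeta\in\Xi_n\,\}$, where $\Xi_n$ is the set of all $\zeta\in\mathbb R$ for which both sides of the following equation are defined (that is, $\cos(\zeta/2)\ne0$ and the denominator on the right is nonzero) and $$\tan\left(\frac\zeta2\right)=\frac{\displaystyle\zeta\sum_{\ell=0}^{\lfloor (n-1)/2\rfloor}(-1)^\ell\frac{(2n-2\ell-1)!}{(2\ell+1)!\,(n-2\ell-1)!}\,\zeta^{2\ell}}{\displaystyle\sum_{\ell=0}^{\lfloor n/2\rfloor}(-1)^\ell\frac{(2n-2\ell)!}{(2\ell)!\,(n-2\ell)!}\,\zeta^{2\ell}} .$$ -/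

import Mathlib

namespace DelayQuasipoly

/-- The characteristic function
`Δ(s) = s ^ n + ∑_{k < n} a k * s ^ k + e ^ (-s τ) * ∑_{k ≤ m} α k * s ^ k` of a linear
delay-differential equation with one delay `τ` and real coefficients. Only the values `a k` for
`k < n` and `α k` for `k ≤ m` are used. -/
noncomputable def charFun (n m : ℕ) (a α : ℕ → ℝ) (τ : ℝ) (s : ℂ) : ℂ :=
  s ^ n + ∑ k ∈ Finset.range n, (a k : ℂ) * s ^ k
    + Complex.exp (-s * (τ : ℂ)) * ∑ k ∈ Finset.range (m + 1), (α k : ℂ) * s ^ k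

/-- `s₀` is a dominant root of `Q`: it is a root, and every other root has real part at most
`Re s₀`. -/
def IsDominantRoot (Q : ℂ → ℂ) (s₀ : ℂ) : Prop :=
  Q s₀ = 0 ∧ ∀ s : ℂ, s ≠ s₀ → Q s = 0 → s.re ≤ s₀.re

/-- `s₀` is a strictly dominant root of `Q`: it is a root, and every other root has real part
less than `Re s₀`. -/
def IsStrictlyDominantRoot (Q : ℂ → ℂ) (s₀ : ℂ) : Prop :=
  Q s₀ = 0 ∧ ∀ s : ℂ, s ≠ s₀ → Q s = 0 → s.re < s₀.re

/-- The explicit conditions on the coefficients `a 0, …, a (n - 1)` and `α 0, …, α m` that express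
that `s₀` is a root of `charFun n m a α τ` of the maximal multiplicity `m + n + 1`.
The index `j` runs over `k ≤ j ≤ n - 1` in the first sum and over `k ≤ j ≤ m` in the second. -/
def MaxMultCoeffs (n m : ℕ) (a α : ℕ → ℝ) (τ s₀ : ℝ) : Prop :=
  (∀ k : ℕ, k < n →
    a k = (n.choose k : ℝ) * (-s₀) ^ (n - k)
      + (-1 : ℝ) ^ (n - k) * (n.factorial : ℝ) *
        ∑ j ∈ Finset.Ico k n,
          ((j.choose k : ℝ) * ((m + n - j).choose m : ℝ) * s₀ ^ (j - k))
            / ((j.factorial : ℝ) * τ ^ (n - j))) ∧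
  (∀ k : ℕ, k ≤ m →
    α k = (-1 : ℝ) ^ (n - 1) * Real.exp (s₀ * τ) *
      ∑ j ∈ Finset.Icc k m,
        ((-1 : ℝ) ^ (j - k) * ((m + n - j).factorial : ℝ) * s₀ ^ (j - k))
          / ((k.factorial : ℝ) * ((j - k).factorial : ℝ) * ((m - j).factorial : ℝ)
              * τ ^ (n - j)))

/-- The numerator
`ζ * ∑_{ℓ ≤ ⌊(n - 1) / 2⌋} (-1) ^ ℓ (2n - 2ℓ - 1)! / ((2ℓ + 1)! (n - 2ℓ - 1)!) ζ ^ (2ℓ)`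
(for `n ≥ 1`). -/
noncomputable def xiNum (n : ℕ) (ζ : ℝ) : ℝ :=
  ζ * ∑ l ∈ Finset.range ((n - 1) / 2 + 1),
    (-1 : ℝ) ^ l
      * (((2 * n - 2 * l - 1).factorial : ℝ)
          / (((2 * l + 1).factorial : ℝ) * ((n - 2 * l - 1).factorial : ℝ)))
      * ζ ^ (2 * l)

/-- The denominator
`∑_{ℓ ≤ ⌊n / 2⌋} (-1) ^ ℓ (2n - 2ℓ)! / ((2ℓ)! (n - 2ℓ)!) ζ ^ (2ℓ)`. -/
noncomputable def xiDen (n : ℕ) (ζ : ℝ) : ℝ :=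
  ∑ l ∈ Finset.range (n / 2 + 1),
    (-1 : ℝ) ^ l
      * (((2 * n - 2 * l).factorial : ℝ)
          / (((2 * l).factorial : ℝ) * ((n - 2 * l).factorial : ℝ)))
      * ζ ^ (2 * l)

/-- The set `Ξ_n` of real solutions `ζ` of `tan (ζ / 2) = xiNum n ζ / xiDen n ζ`. The first two
conditions say that `tan (ζ / 2)` and the quotient are defined. -/
def Xi (n : ℕ) : Set ℝ :=
  {ζ : ℝ | Real.cos (ζ / 2) ≠ 0 ∧ xiDen n ζ ≠ 0 ∧ Real.tan (ζ / 2) = xiNum n ζ / xiDen n ζ}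

end DelayQuasipoly

/-!
Put `z = τ (s - s₀)`. The coefficient conditions say exactly that the characteristic function is a
constant multiple of the error `A (-z) - e ^ (-z) B z` of a Padé approximation of the exponential
function, where `A = padePoly m n` and `B = padePoly n m` (`charFun_eq`). Repeated integration by
parts writes this error, up to sign, as `z ^ (m + n + 1) ∫₀¹ u ^ m (1 - u) ^ n e ^ (-z u) du`
(`pow_mul_betaLaplace`). Hence the roots other than `s₀` are the zeros of the integral
`betaLaplace m n`, a Kummer function without real zeros.

The location of these zeros comes from Kummer's differential equation (`kummer_ode`). For a zero `z`
one multiplies the equation along the segment from `0` to `z`, brought into self-adjoint form, by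
the conjugate of the solution. The imaginary part integrates to
`∫₀¹ t ^ (m + n + 1) (t Re z + n - m) |h t| ^ 2 dt = 0` with a nonzero continuous function `h`, so
`t Re z + n - m` cannot have a constant sign on `(0, 1)` (`not_sign_of_betaLaplace_eq_zero`). This
forces `Re z < 0` if `m < n` and `Re z = 0` if `m = n`.

If `m = n` and `z = i ζ`, then `A = B` takes conjugate values at `± i ζ`, with real part
`xiDen n ζ` and imaginary part `xiNum n ζ` up to a common factor, and the root equation reads
`sin (ζ / 2) xiDen n ζ = cos (ζ / 2) xiNum n ζ` (`pade_error_I_mul_eq_zero_iff`). To divide by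
`cos (ζ / 2)` and `xiDen n ζ` (`mem_Xi_iff`), two degenerate cases have to be excluded. That
`xiNum n` and `xiDen n` have no common zero follows from the Wronskian of `A` and its reflection
(`eq_zero_of_aeval_padePoly_eq_zero`). That `xiDen n` does not vanish at an odd multiple of `π` needs
the transcendence of `π`: an algebraic `θ` never satisfies `e ^ θ = -1`
(`exp_ne_neg_one_of_isAlgebraic`). This is derived by Lindemann's argument from the simultaneous
approximations `LindemannWeierstrass.exp_polynomial_approx`.
-/

namespace DelayQuasipoly

/-! ### Exponentials of algebraic numbers -/

open Polynomial in
/-- Multiplying a value of an integer polynomial by a power of a denominator of the argument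
clears all denominators. -/
theorem isIntegral_pow_mul_aeval {K : Type*} [Field K] {a : ℤ} {β : K}
    (hβ : IsIntegral ℤ ((a : K) * β)) (g : ℤ[X]) {D : ℕ} (hD : g.natDegree ≤ D) :
    IsIntegral ℤ ((a : K) ^ D * aeval β g) := by
  rw [aeval_eq_sum_range, Finset.mul_sum]
  refine IsIntegral.sum _ fun i hi => ?_
  have hi' : i ≤ D := (Nat.lt_succ_iff.mp (Finset.mem_range.mp hi)).trans hD
  have h : (a : K) ^ D * g.coeff i • β ^ i
      = ((g.coeff i * a ^ (D - i) : ℤ) : K) * ((a : K) * β) ^ i := by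
    rw [zsmul_eq_mul, mul_pow, ← Nat.sub_add_cancel hi', pow_add, Nat.add_sub_cancel]
    push_cast
    ring
  rw [h]
  exact (isIntegral_algebraMap (R := ℤ) (A := K) (x := g.coeff i * a ^ (D - i))).mul (hβ.pow i)

/-- A positive integer plus the sum of the exponentials of a Galois-stable family of nonzero
algebraic numbers is never zero. Up to an error which is too small, the Hermite approximations
`n * exp β ≈ p * g β` would turn such a vanishing sum into an integer that is not divisible
by `p`. -/
theorem natCast_add_sum_exp_ne_zero {K ι : Type*} [Field K] [Algebra ℚ K] [FiniteDimensional ℚ K]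
    [IsGalois ℚ K] (φ : K →+* ℂ) (s : Finset ι) (β : ι → K) (hβ : ∀ i ∈ s, β i ≠ 0)
    (hstable : ∀ σ : K ≃ₐ[ℚ] K, ∃ e : ι ≃ ι, (∀ i, i ∈ s ↔ e i ∈ s) ∧ ∀ i, σ (β i) = β (e i))
    {k : ℕ} (hk : k ≠ 0) : (k : ℂ) + ∑ i ∈ s, Complex.exp (φ (β i)) ≠ 0 := by
  classical
  intro hzero
  have : CharZero K := algebraRat.charZero K
  have : Algebra.IsAlgebraic ℤ K :=
    ⟨fun x => (IsFractionRing.isAlgebraic_iff ℤ ℚ K).mpr (Algebra.IsAlgebraic.isAlgebraic x)⟩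
  obtain ⟨a, ha0, ha⟩ := Algebra.IsAlgebraic.exists_integral_multiples ℤ (s.image β)
  replace ha : ∀ i ∈ s, IsIntegral ℤ ((a : K) * β i) := fun i hi => by
    simpa [zsmul_eq_mul] using ha (β i) (Finset.mem_image_of_mem β hi)
  -- an integer polynomial that vanishes at all `β i` but not at `0`
  have hq : ∀ x : K, ∃ q : Polynomial ℤ, q.coeff 0 ≠ 0 ∧ (x ≠ 0 → Polynomial.aeval x q = 0) := by
    intro x
    by_cases hx : x = 0
    · exact ⟨1, by simp, fun h => absurd hx h⟩
    · obtain ⟨q, h0, h1⟩ := (Algebra.IsAlgebraic.isAlgebraic (R := ℤ)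
        x).exists_nonzero_coeff_and_aeval_eq_zero (mem_nonZeroDivisors_of_ne_zero hx)
      exact ⟨q, h0, fun _ => h1⟩
  choose q hq0 hqx using hq
  set f : Polynomial ℤ := ∏ i ∈ s, q (β i) with hf
  have hf0 : f.eval 0 ≠ 0 := by
    rw [hf, Polynomial.eval_prod]
    refine Finset.prod_ne_zero_iff.mpr fun i _ => ?_
    rw [← Polynomial.coeff_zero_eq_eval_zero]
    exact hq0 _
  have hfroot : ∀ i ∈ s, φ (β i) ∈ f.aroots ℂ := by
    intro i hi
    rw [Polynomial.mem_aroots]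
    refine ⟨fun h => hf0 (by simp [h]), ?_⟩
    have h1 : Polynomial.aeval (φ (β i)) f = φ (Polynomial.aeval (β i) f) :=
      Polynomial.aeval_algHom_apply φ.toIntAlgHom (β i) f
    rw [h1, hf, map_prod, Finset.prod_eq_zero hi (hqx _ (hβ i hi)), map_zero]
  obtain ⟨c, hc⟩ := LindemannWeierstrass.exp_polynomial_approx f hf0
  -- a prime which is so large that the approximation error is negligible
  obtain ⟨p, hp, hpk, hpa, hpf, hsmall⟩ : ∃ p : ℕ, p.Prime ∧ k < p ∧ a.natAbs < p ∧
      (f.eval 0).natAbs < p ∧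
      (s.card : ℝ) * (|(a : ℝ)| ^ (p * f.natDegree) * (|c| ^ p / (p - 1).factorial)) < 1 := by
    set C : ℝ := |(a : ℝ)| ^ f.natDegree * |c| with hC
    have hlim := (FloorSemiring.tendsto_pow_div_factorial_atTop C).const_mul ((s.card : ℝ) * C)
    rw [mul_zero] at hlim
    obtain ⟨N, hN⟩ := Filter.eventually_atTop.mp (hlim.eventually (gt_mem_nhds one_pos))
    obtain ⟨p, hple, hp⟩ :=
      Nat.exists_infinite_primes (N + 1 + (k + 1) + (a.natAbs + 1) + ((f.eval 0).natAbs + 1))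
    refine ⟨p, hp, by omega, by omega, by omega, ?_⟩
    have h := hN (p - 1) (by omega)
    have hpp : p - 1 + 1 = p := by omega
    calc (s.card : ℝ) * (|(a : ℝ)| ^ (p * f.natDegree) * (|c| ^ p / (p - 1).factorial))
        = s.card * (C ^ p / (p - 1).factorial) := by
          rw [hC, mul_pow, ← pow_mul, mul_comm p]; ring
      _ = s.card * C * (C ^ (p - 1) / (p - 1).factorial) := by
          conv_lhs => rw [← hpp, pow_succ, Nat.add_sub_cancel]
          ring
      _ < 1 := h
  obtain ⟨n, hpn, g, hgdeg, hg⟩ := hc p hpf hp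
  set D := p * f.natDegree with hD
  set T : K := ∑ i ∈ s, (a : K) ^ D * Polynomial.aeval (β i) g with hT
  -- `T` is an algebraic integer that is fixed by the Galois group
  have hTint : IsIntegral ℤ T := IsIntegral.sum _ fun i hi =>
    isIntegral_pow_mul_aeval (ha i hi) g (hgdeg.trans (Nat.sub_le _ _))
  have hTrat : T ∈ Set.range (algebraMap ℚ K) := by
    rw [IsGalois.mem_range_algebraMap_iff_fixed]
    intro σ
    obtain ⟨e, hes, heσ⟩ := hstable σ
    rw [hT, map_sum]
    refine Finset.sum_equiv e hes fun i _ => ?_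
    rw [map_mul, map_pow, map_intCast, ← heσ]
    congr 1
    exact (Polynomial.aeval_algHom_apply (σ : K →+* K).toIntAlgHom (β i) g).symm
  obtain ⟨r, hr⟩ := hTrat
  obtain ⟨M, hM⟩ : ∃ M : ℤ, T = M := by
    have hrint : IsIntegral ℤ r := by
      rw [← hr] at hTint
      exact (isIntegral_algebraMap_iff (algebraMap ℚ K).injective).mp hTint
    obtain ⟨M, hM⟩ := IsIntegrallyClosed.isIntegral_iff.mp hrint
    exact ⟨M, by rw [← hr, ← hM]; simp⟩
  have hφT : ∑ i ∈ s, (a : ℂ) ^ D * Polynomial.aeval (φ (β i)) g = M := by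
    have h := congrArg φ hM
    rw [hT, map_sum, map_intCast] at h
    rw [← h]
    refine Finset.sum_congr rfl fun i _ => ?_
    rw [map_mul, map_pow, map_intCast]
    congr 1
    exact Polynomial.aeval_algHom_apply φ.toIntAlgHom (β i) g
  have hkey : (((a ^ D * n * k + p * M : ℤ)) : ℂ)
      = -∑ i ∈ s, (a : ℂ) ^ D * (n • Complex.exp (φ (β i)) - p • Polynomial.aeval (φ (β i)) g) := by
    have h1 : ∑ i ∈ s, Complex.exp (φ (β i)) = -k := eq_neg_of_add_eq_zero_right hzero
    have h2 : ∑ i ∈ s, (a : ℂ) ^ D *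
          (n • Complex.exp (φ (β i)) - p • Polynomial.aeval (φ (β i)) g)
        = (a : ℂ) ^ D * n * ∑ i ∈ s, Complex.exp (φ (β i))
          - p * ∑ i ∈ s, (a : ℂ) ^ D * Polynomial.aeval (φ (β i)) g := by
      rw [Finset.mul_sum, Finset.mul_sum, ← Finset.sum_sub_distrib]
      refine Finset.sum_congr rfl fun i _ => ?_
      rw [zsmul_eq_mul, nsmul_eq_mul]
      ring
    rw [h2, h1, hφT]
    push_cast
    ring
  have hlt : ‖((a ^ D * n * k + p * M : ℤ) : ℂ)‖ < 1 := by
    rw [hkey, norm_neg]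
    refine lt_of_le_of_lt ?_ hsmall
    rw [← nsmul_eq_mul]
    refine (norm_sum_le _ _).trans (Finset.sum_le_card_nsmul _ _ _ fun i hi => ?_)
    rw [norm_mul, norm_pow, Complex.norm_intCast]
    gcongr
    refine (hg (hfroot i hi)).trans ?_
    exact div_le_div_of_nonneg_right ((le_abs_self _).trans_eq (abs_pow c p)) (by positivity)
  have hz : a ^ D * n * k + p * M = 0 := by
    rw [Complex.norm_intCast] at hlt
    exact Int.abs_lt_one_iff.mp (by exact_mod_cast hlt)
  have hdvd : (p : ℤ) ∣ a ^ D * n * k :=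
    ⟨-M, by linear_combination hz⟩
  have hpZ : Prime (p : ℤ) := Nat.prime_iff_prime_int.mp hp
  rcases hpZ.dvd_or_dvd hdvd with h | h
  · rcases hpZ.dvd_or_dvd h with h | h
    · have := Int.natAbs_dvd_natAbs.mpr (hpZ.dvd_of_dvd_pow h)
      rw [Int.natAbs_natCast] at this
      exact absurd (Nat.le_of_dvd (Int.natAbs_pos.mpr ha0) this) (by omega)
    · exact hpn h
  · exact absurd (Nat.le_of_dvd (Nat.pos_of_ne_zero hk) (Int.natCast_dvd_natCast.mp h)) (by omega)

/-- Lindemann's theorem on `π`, in the form used here: expand the product of `1 + exp (σ θ)` over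
the Galois group into exponentials of the sums of conjugates of `θ`. -/
theorem exp_ne_neg_one_of_isAlgebraic {θ : ℂ} (hθ : IsAlgebraic ℚ θ) : Complex.exp θ ≠ -1 := by
  classical
  intro hexp
  set K : IntermediateField ℚ ℂ := IntermediateField.adjoin ℚ ((minpoly ℚ θ).rootSet ℂ) with hK
  have hsplit : (minpoly ℚ θ).IsSplittingField ℚ K :=
    IntermediateField.adjoin_rootSet_isSplittingField (IsAlgClosed.splits _)
  have : FiniteDimensional ℚ K := Polynomial.IsSplittingField.finiteDimensional K (minpoly ℚ θ)
  have : Normal ℚ K := Normal.of_isSplittingField (minpoly ℚ θ)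
  have : IsGalois ℚ K := ⟨⟩
  have hmem : θ ∈ K := IntermediateField.subset_adjoin ℚ _ <| by
    rw [Polynomial.mem_rootSet]
    exact ⟨minpoly.ne_zero hθ.isIntegral, minpoly.aeval ℚ θ⟩
  set x : K := ⟨θ, hmem⟩ with hx
  set φ : K →+* ℂ := algebraMap K ℂ with hφ
  set β : Finset (K ≃ₐ[ℚ] K) → K := fun S => ∑ σ ∈ S, σ x with hβ
  have hsum : ∑ S : Finset (K ≃ₐ[ℚ] K), Complex.exp (φ (β S)) = 0 := by
    have h1 : ∏ σ : K ≃ₐ[ℚ] K, (1 + Complex.exp (φ (σ x))) = 0 :=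
      Finset.prod_eq_zero (Finset.mem_univ (1 : K ≃ₐ[ℚ] K)) <| by
        have : φ ((1 : K ≃ₐ[ℚ] K) x) = θ := rfl
        rw [this, hexp, add_neg_cancel]
    rw [Finset.prod_one_add, Finset.powerset_univ] at h1
    rw [← h1]
    refine Finset.sum_congr rfl fun S _ => ?_
    rw [hβ, map_sum, Complex.exp_sum]
  rw [← Finset.sum_filter_add_sum_filter_not Finset.univ (fun S => β S = 0)] at hsum
  rw [Finset.sum_congr rfl (g := fun _ => (1 : ℂ)) (fun S hS => by
    rw [(Finset.mem_filter.mp hS).2, map_zero, Complex.exp_zero]), Finset.sum_const,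
    nsmul_one] at hsum
  refine natCast_add_sum_exp_ne_zero φ (Finset.univ.filter fun S => ¬ β S = 0) β
    (fun S hS => (Finset.mem_filter.mp hS).2) (fun σ => ?_) ?_ hsum
  · have hσ : ∀ S, σ (β S) = β ((Equiv.mulLeft σ).finsetCongr S) := fun S => by
      simp [hβ, map_sum, Equiv.finsetCongr_apply, Finset.sum_map]
    refine ⟨(Equiv.mulLeft σ).finsetCongr, fun S => ?_, hσ⟩
    simp only [Finset.mem_filter, Finset.mem_univ, true_and]
    rw [← hσ, map_eq_zero]
  · exact Finset.card_ne_zero_of_mem (a := (∅ : Finset (K ≃ₐ[ℚ] K)))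
      (by simp [hβ])

/-! ### The Laplace transform of a beta density -/

/-- The integral `∫₀¹ u ^ m (1 - u) ^ n e ^ (-z u) du`, which is up to a constant factor Kummer's
confluent hypergeometric function `₁F₁(m + 1; m + n + 2; -z)`. -/
noncomputable def betaLaplace (m n : ℕ) (z : ℂ) : ℂ :=
  ∫ u in (0 : ℝ)..1, (u : ℂ) ^ m * (1 - (u : ℂ)) ^ n * Complex.exp (-z * u)

theorem hasDerivAt_betaLaplace (m n : ℕ) (z : ℂ) :
    HasDerivAt (betaLaplace m n) (-betaLaplace (m + 1) n z) z := by
  have key := intervalIntegral.hasDerivAt_integral_of_dominated_loc_of_deriv_le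
    (μ := MeasureTheory.volume) (a := (0 : ℝ)) (b := 1) (x₀ := z)
    (F := fun (w : ℂ) (u : ℝ) => (u : ℂ) ^ m * (1 - (u : ℂ)) ^ n * Complex.exp (-w * u))
    (F' := fun (w : ℂ) (u : ℝ) => (u : ℂ) ^ m * (1 - (u : ℂ)) ^ n *
      (Complex.exp (-w * u) * (-u)))
    (bound := fun _ => Real.exp (‖z‖ + 1)) (Metric.ball_mem_nhds z one_pos)
    (.of_forall fun w => (by fun_prop : Continuous _).aestronglyMeasurable)
    ((by fun_prop : Continuous _).intervalIntegrable _ _)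
    (by fun_prop : Continuous _).aestronglyMeasurable
    (.of_forall fun u hu w hw => ?_)
    intervalIntegrable_const
    (.of_forall fun u _ w _ => ?_)
  · refine key.2.congr_deriv ?_
    rw [betaLaplace, ← intervalIntegral.integral_neg]
    congr 1
    funext u
    ring
  · rw [Set.uIoc_of_le zero_le_one] at hu
    have hu1 : ‖(u : ℂ)‖ ≤ 1 := by
      rw [Complex.norm_real, Real.norm_of_nonneg hu.1.le]; exact hu.2
    have hu2 : ‖1 - (u : ℂ)‖ ≤ 1 := by
      rw [← Complex.ofReal_one, ← Complex.ofReal_sub, Complex.norm_real,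
        Real.norm_of_nonneg (by linarith [hu.2])]
      linarith [hu.1]
    have hexp : ‖Complex.exp (-w * u)‖ ≤ Real.exp (‖z‖ + 1) := by
      refine (Complex.norm_exp_le_exp_norm _).trans (Real.exp_le_exp.mpr ?_)
      have hw' : ‖w‖ ≤ ‖z‖ + 1 := by
        have h1 : ‖w - z‖ < 1 := by rwa [← dist_eq_norm]
        linarith [norm_le_norm_add_norm_sub' w z]
      rw [norm_mul, norm_neg]
      calc ‖w‖ * ‖(u : ℂ)‖ ≤ ‖w‖ * 1 := by gcongr
        _ ≤ ‖z‖ + 1 := by rwa [mul_one]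
    rw [norm_mul, norm_mul, norm_mul, norm_neg, norm_pow, norm_pow]
    calc ‖(u : ℂ)‖ ^ m * ‖1 - (u : ℂ)‖ ^ n * (‖Complex.exp (-w * u)‖ * ‖(u : ℂ)‖)
        ≤ 1 ^ m * 1 ^ n * (Real.exp (‖z‖ + 1) * 1) := by gcongr
      _ = Real.exp (‖z‖ + 1) := by simp
  · refine HasDerivAt.const_mul _ (HasDerivAt.cexp ?_)
    simpa using! ((hasDerivAt_id w).neg).mul_const (u : ℂ)

/-- Kummer's differential equation, written with the derivatives `-betaLaplace (m + 1) n` and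
`betaLaplace (m + 2) n` of `betaLaplace m n`. The left side is the integral of the derivative of
`u ^ (m + 1) (1 - u) ^ (n + 1) e ^ (-z u)`. -/
theorem kummer_ode (m n : ℕ) (z : ℂ) :
    z * betaLaplace (m + 2) n z - (m + n + 2 + z) * betaLaplace (m + 1) n z
      + (m + 1) * betaLaplace m n z = 0 := by
  have hd : ∀ u : ℝ, HasDerivAt
      (fun u : ℝ => (u : ℂ) ^ (m + 1) * (1 - (u : ℂ)) ^ (n + 1) * Complex.exp (-z * u))
      (z * ((u : ℂ) ^ (m + 2) * (1 - (u : ℂ)) ^ n * Complex.exp (-z * u))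
        - (m + n + 2 + z) * ((u : ℂ) ^ (m + 1) * (1 - (u : ℂ)) ^ n * Complex.exp (-z * u))
        + (m + 1) * ((u : ℂ) ^ m * (1 - (u : ℂ)) ^ n * Complex.exp (-z * u))) u := by
    intro u
    have h0 : HasDerivAt (fun u : ℝ => (u : ℂ)) 1 u := Complex.ofRealCLM.hasDerivAt
    have h1 := (h0.fun_pow (m + 1)).fun_mul ((h0.const_sub 1).fun_pow (n + 1))
    have h2 := h1.fun_mul ((h0.const_mul (-z)).cexp)
    refine h2.congr_deriv ?_
    simp only [Nat.add_sub_cancel]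
    push_cast
    ring
  have hint := intervalIntegral.integral_eq_sub_of_hasDerivAt (a := 0) (b := 1)
    (fun u _ => hd u) ((by fun_prop : Continuous _).intervalIntegrable _ _)
  rw [intervalIntegral.integral_add, intervalIntegral.integral_sub,
    intervalIntegral.integral_const_mul, intervalIntegral.integral_const_mul,
    intervalIntegral.integral_const_mul] at hint
  · rw [betaLaplace, betaLaplace, betaLaplace, hint]
    simp
  all_goals exact (by fun_prop : Continuous _).intervalIntegrable _ _

theorem betaLaplace_ofReal_ne_zero (m n : ℕ) (x : ℝ) : betaLaplace m n x ≠ 0 := by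
  have h : betaLaplace m n x
      = ((∫ u in (0 : ℝ)..1, u ^ m * (1 - u) ^ n * Real.exp (-x * u) : ℝ) : ℂ) := by
    rw [← intervalIntegral.integral_ofReal, betaLaplace]
    congr 1
    funext u
    push_cast
    rfl
  rw [h, Complex.ofReal_ne_zero]
  refine (intervalIntegral.intervalIntegral_pos_of_pos_on
    ((by fun_prop : Continuous _).intervalIntegrable _ _) (fun u hu => ?_) one_pos).ne'
  have h1 := hu.1
  have h2 : 0 < 1 - u := sub_pos.mpr hu.2
  positivity

open ComplexConjugate in
/-- The Green–Hurwitz transformation. With `h t = e ^ (t z / 2) betaLaplace m n (t z)` and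
`b = m + n + 2`, Kummer's equation says `(t ^ b h')' = (t ^ b z ^ 2 / 4 + t ^ (b - 1) z (n - m) / 2) h`.
Hence `Im (t ^ b h' conj h)` has the derivative
`Im z * t ^ (b - 1) * (t * Re z / 2 + (n - m) / 2) * |h| ^ 2`; it vanishes at `0`, and at `1` as well
when `z` is a zero of `betaLaplace m n`, so this derivative cannot have a constant sign. -/
theorem not_sign_of_betaLaplace_eq_zero {m n : ℕ} {z : ℂ} (hz : betaLaplace m n z = 0) (ε : ℝ)
    (hε : ∀ t : ℝ, 0 < t → t < 1 → 0 < ε * (t * z.re / 2 + ((n : ℝ) - m) / 2)) : False := by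
  have hy : z.im ≠ 0 := by
    intro hy
    have hzx : z = (z.re : ℂ) := Complex.ext (by simp) (by simpa using hy)
    rw [hzx] at hz
    exact betaLaplace_ofReal_ne_zero m n _ hz
  set h : ℝ → ℂ := fun t => Complex.exp (t * z / 2) * betaLaplace m n (t * z) with hh
  set k : ℝ → ℂ := fun t => z * Complex.exp (t * z / 2) *
    (betaLaplace m n (t * z) / 2 - betaLaplace (m + 1) n (t * z)) with hk
  have hofReal : ∀ t : ℝ, HasDerivAt (fun t : ℝ => (t : ℂ)) 1 t := fun t =>
    Complex.ofRealCLM.hasDerivAt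
  have hL : ∀ (j : ℕ) (t : ℝ), HasDerivAt (fun t : ℝ => betaLaplace j n (t * z))
      (-betaLaplace (j + 1) n (t * z) * (1 * z)) t := fun j t =>
    HasDerivAt.comp (h₂ := betaLaplace j n) (h := fun t : ℝ => (t : ℂ) * z) t
      (hasDerivAt_betaLaplace j n (t * z)) ((hofReal t).mul_const z)
  have hE : ∀ t : ℝ, HasDerivAt (fun t : ℝ => Complex.exp (t * z / 2))
      (Complex.exp (t * z / 2) * (1 * z / 2)) t := fun t =>
    (((hofReal t).mul_const z).div_const 2).cexp
  have hh' : ∀ t, HasDerivAt h (k t) t := fun t => by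
    refine ((hE t).fun_mul (hL m t)).congr_deriv ?_
    simp only [hk]
    ring
  have hk' : ∀ t : ℝ, HasDerivAt (fun t : ℝ => (t : ℂ) ^ (m + n + 2) * k t)
      (((t : ℂ) ^ (m + n + 2) * z ^ 2 / 4 + (t : ℂ) ^ (m + n + 1) * z * ((n : ℂ) - m) / 2) * h t)
      t := fun t => by
    have h1 := ((hE t).const_mul z).fun_mul (((hL m t).div_const 2).fun_sub (hL (m + 1) t))
    refine (((hofReal t).fun_pow (m + n + 2)).fun_mul h1).congr_deriv ?_
    have hode := kummer_ode m n (t * z)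
    simp only [hh, show m + n + 2 - 1 = m + n + 1 from rfl]
    push_cast
    linear_combination ((t : ℂ) ^ (m + n + 1) * z * Complex.exp (t * z / 2)) * hode
  have hφ : ∀ t : ℝ, HasDerivAt
      (fun t : ℝ => ((t : ℂ) ^ (m + n + 2) * k t * conj (h t)).im)
      (z.im * t ^ (m + n + 1) * (t * z.re / 2 + ((n : ℝ) - m) / 2) * Complex.normSq (h t)) t :=
    fun t => by
    have h1 := (hk' t).fun_mul ((hh' t).star)
    have h2 := Complex.imCLM.hasFDerivAt.comp_hasDerivAt t h1
    refine h2.congr_deriv ?_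
    have e1 : ∀ w : ℂ, w * h t * conj (h t) = w * (Complex.normSq (h t) : ℂ) := fun w => by
      rw [mul_assoc, Complex.mul_conj]
    have e2 : (t : ℂ) ^ (m + n + 2) * k t * conj (k t)
        = ((t ^ (m + n + 2) * Complex.normSq (k t) : ℝ) : ℂ) := by
      rw [mul_assoc, Complex.mul_conj]; push_cast; rfl
    have e3 : (t : ℂ) ^ (m + n + 2) * z ^ 2 / 4 + (t : ℂ) ^ (m + n + 1) * z * ((n : ℂ) - m) / 2
        = ((t ^ (m + n + 2) / 4 : ℝ) : ℂ) * z ^ 2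
          + ((t ^ (m + n + 1) * ((n : ℝ) - m) / 2 : ℝ) : ℂ) * z := by
      push_cast; ring
    simp only [Complex.imCLM_apply, Complex.star_def]
    rw [e1, e2, e3, Complex.add_im, Complex.ofReal_im, add_zero, Complex.im_mul_ofReal,
      Complex.add_im, Complex.im_ofReal_mul, Complex.im_ofReal_mul, pow_two z, Complex.mul_im]
    ring
  set ψ : ℝ → ℝ := fun t =>
    ε * z.im * ((t : ℂ) ^ (m + n + 2) * k t * conj (h t)).im with hψ
  set ψ' : ℝ → ℝ := fun t => z.im ^ 2 * t ^ (m + n + 1) *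
    (ε * (t * z.re / 2 + ((n : ℝ) - m) / 2)) * Complex.normSq (h t) with hψ'
  have hder : ∀ t, HasDerivAt ψ (ψ' t) t := fun t => by
    refine ((hφ t).const_mul (ε * z.im)).congr_deriv ?_
    simp only [hψ']
    ring
  have hψ0 : ψ 0 = 0 := by simp [hψ]
  have hψ1 : ψ 1 = 0 := by simp [hψ, hh, hz]
  have hmono : MonotoneOn ψ (Set.Icc 0 1) := by
    refine monotoneOn_of_deriv_nonneg (convex_Icc 0 1)
      (fun t _ => (hder t).continuousAt.continuousWithinAt)
      (fun t _ => (hder t).differentiableAt.differentiableWithinAt) fun t ht => ?_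
    rw [interior_Icc] at ht
    rw [(hder t).deriv]
    have h1 := (hε t ht.1 ht.2).le
    have h2 := Complex.normSq_nonneg (h t)
    have h3 := ht.1.le
    positivity
  have hzero : ∀ t ∈ Set.Ioo (0 : ℝ) 1, h t = 0 := by
    intro t ht
    have hconst : ψ =ᶠ[nhds t] fun _ => 0 := by
      filter_upwards [Ioo_mem_nhds ht.1 ht.2] with s hs
      refine le_antisymm ?_ ?_
      · rw [← hψ1]
        exact hmono ⟨hs.1.le, hs.2.le⟩ (Set.right_mem_Icc.mpr zero_le_one) hs.2.le
      · rw [← hψ0]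
        exact hmono (Set.left_mem_Icc.mpr zero_le_one) ⟨hs.1.le, hs.2.le⟩ hs.1.le
    have h0 : ψ' t = 0 := by
      rw [← (hder t).deriv, hconst.deriv_eq, deriv_const]
    have hpos : z.im ^ 2 * t ^ (m + n + 1) * (ε * (t * z.re / 2 + ((n : ℝ) - m) / 2)) ≠ 0 :=
      mul_ne_zero (mul_ne_zero (pow_ne_zero 2 hy) (pow_ne_zero _ ht.1.ne')) (hε t ht.1 ht.2).ne'
    exact Complex.normSq_eq_zero.mp ((mul_eq_zero.mp h0).resolve_left hpos)
  -- by continuity `h 0`, which is the integral of a beta density, would vanish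
  have hlim : Filter.Tendsto h (nhdsWithin 0 (Set.Ioi 0)) (nhds (h 0)) :=
    (hh' 0).continuousAt.continuousWithinAt
  have hlim' : Filter.Tendsto h (nhdsWithin 0 (Set.Ioi 0)) (nhds 0) :=
    tendsto_const_nhds.congr' <| by
      filter_upwards [Ioo_mem_nhdsGT (zero_lt_one (α := ℝ))] with t ht
      exact (hzero t ht).symm
  have h00 : h 0 = 0 := tendsto_nhds_unique hlim hlim'
  refine betaLaplace_ofReal_ne_zero m n 0 ?_
  simpa [hh] using h00

theorem re_neg_of_betaLaplace_eq_zero {m n : ℕ} (hmn : m < n) {z : ℂ}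
    (hz : betaLaplace m n z = 0) : z.re < 0 := by
  by_contra! hx
  refine not_sign_of_betaLaplace_eq_zero hz 1 fun t ht _ => ?_
  have h1 : (m : ℝ) < n := Nat.cast_lt.mpr hmn
  have h2 : 0 ≤ t * z.re := mul_nonneg ht.le hx
  linarith

theorem re_eq_zero_of_betaLaplace_self_eq_zero {n : ℕ} {z : ℂ} (hz : betaLaplace n n z = 0) :
    z.re = 0 := by
  by_contra hx
  refine not_sign_of_betaLaplace_eq_zero hz z.re fun t ht _ => ?_
  have h1 : 0 < z.re * z.re := mul_self_pos.mpr hx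
  have h2 : z.re * (t * z.re / 2 + ((n : ℝ) - n) / 2) = t * (z.re * z.re) / 2 := by ring
  rw [h2]
  positivity

open Polynomial

/-! ### The Padé polynomials of the exponential function -/

/-- The polynomial `∑ j ≤ n, (n.choose j) (m + n - j)! X ^ j`. The quotient of `padePoly m n` by
the reflection of `padePoly n m` is the Padé approximant of the exponential function with numerator
of degree `n` and denominator of degree `m`; `padePoly n n` is a multiple of a rescaled reverse
Bessel polynomial. -/
noncomputable def padePoly (m n : ℕ) : ℤ[X] :=
  ∑ j ∈ Finset.range (n + 1), C ((n.choose j * (m + n - j).factorial : ℕ) : ℤ) * X ^ j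

theorem coeff_padePoly (m n k : ℕ) :
    (padePoly m n).coeff k = (n.choose k * (m + n - k).factorial : ℕ) := by
  simp only [padePoly, finsetSum_coeff, coeff_C_mul_X_pow]
  rw [Finset.sum_ite_eq]
  split_ifs with h
  · rfl
  · rw [Nat.choose_eq_zero_of_lt (by simpa using h)]
    simp

theorem natDegree_padePoly_le (m n : ℕ) : (padePoly m n).natDegree ≤ n := by
  rw [natDegree_le_iff_coeff_eq_zero]
  intro k hk
  rw [coeff_padePoly, Nat.choose_eq_zero_of_lt hk]
  simp

theorem aeval_padePoly (m n : ℕ) (z : ℂ) :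
    aeval z (padePoly m n)
      = ∑ j ∈ Finset.range (n + 1), (n.choose j : ℂ) * ((m + n - j).factorial : ℂ) * z ^ j := by
  simp [padePoly]

theorem eval_sumIDeriv_C_mul_X_sub_C_pow (c z : ℂ) (d : ℕ) :
    (sumIDeriv (C c * (X - C z) ^ d)).eval z = c * d.factorial := by
  rw [← smul_eq_C_mul, map_smul, eval_smul, smul_eq_mul]
  congr 1
  rw [sumIDeriv_apply_of_le (n := d) (by
    rw [natDegree_pow, natDegree_X_sub_C, mul_one]), eval_finsetSum,
    Finset.sum_range_succ, Finset.sum_eq_zero, zero_add, iterate_derivative_X_sub_pow_self]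
  · simp
  · intro k hk
    rw [iterate_derivative_X_sub_pow]
    simp [Nat.sub_ne_zero_of_lt (Finset.mem_range.mp hk)]

/-- The error of Padé approximation of the exponential function in integral form. -/
theorem pow_mul_betaLaplace (m n : ℕ) (z : ℂ) :
    z ^ (m + n + 1) * betaLaplace m n z
      = (-1) ^ n * (aeval (-z) (padePoly m n) - Complex.exp (-z) * aeval z (padePoly n m)) := by
  set p : ℂ[X] := X ^ m * (C z - X) ^ n with hp
  have h := LindemannWeierstrass.integral_exp_mul_eval p z
  have hleft : z * ∫ x in (0 : ℝ)..1, Complex.exp (-(x • z)) * p.eval (x • z)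
      = z ^ (m + n + 1) * betaLaplace m n z := by
    rw [betaLaplace, ← intervalIntegral.integral_const_mul, ← intervalIntegral.integral_const_mul]
    congr 1
    funext x
    simp only [hp, eval_mul, eval_pow, eval_X, eval_sub, eval_C, Complex.real_smul]
    rw [show z - (x : ℂ) * z = (1 - (x : ℂ)) * z by ring, mul_pow, mul_pow,
      show -((x : ℂ) * z) = -z * x by ring]
    ring
  have hzero : (sumIDeriv p).eval 0 = (-1) ^ n * aeval (-z) (padePoly m n) := by
    have hp' : p = ∑ j ∈ Finset.range (n + 1),
        C (z ^ j * (-1) ^ (n - j) * n.choose j) * (X - C 0) ^ (m + n - j) := by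
      rw [hp, sub_eq_add_neg, add_pow, Finset.mul_sum]
      refine Finset.sum_congr rfl fun j hj => ?_
      have hj' : j ≤ n := Nat.lt_succ_iff.mp (Finset.mem_range.mp hj)
      rw [Nat.add_sub_assoc hj', pow_add, neg_pow (X : ℂ[X])]
      simp only [C_0, sub_zero, map_mul, map_pow, map_neg, map_one, map_natCast]
      ring
    rw [hp', map_sum, eval_finsetSum, aeval_padePoly, Finset.mul_sum]
    refine Finset.sum_congr rfl fun j hj => ?_
    have hj' : j ≤ n := Nat.lt_succ_iff.mp (Finset.mem_range.mp hj)
    rw [eval_sumIDeriv_C_mul_X_sub_C_pow, neg_pow z]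
    have hsign : (-1 : ℂ) ^ n * (-1) ^ j = (-1) ^ (n - j) := by
      rw [← pow_add, ← Nat.sub_add_cancel hj', Nat.add_sub_cancel, add_assoc, ← two_mul, pow_add,
        pow_mul]
      simp
    rw [← hsign]
    ring
  have hone : (sumIDeriv p).eval z = (-1) ^ n * aeval z (padePoly n m) := by
    have hp' : p = ∑ j ∈ Finset.range (m + 1),
        C (z ^ j * (-1) ^ n * m.choose j) * (X - C z) ^ (n + m - j) := by
      rw [hp, show (C z - X : ℂ[X]) = -(X - C z) by ring, neg_pow (X - C z),
        show (X : ℂ[X]) ^ m = (C z + (X - C z)) ^ m by ring, add_pow, Finset.sum_mul]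
      refine Finset.sum_congr rfl fun j hj => ?_
      have hj' : j ≤ m := Nat.lt_succ_iff.mp (Finset.mem_range.mp hj)
      rw [Nat.add_sub_assoc hj', pow_add]
      simp only [map_mul, map_pow, map_neg, map_one, map_natCast]
      ring
    rw [hp', map_sum, eval_finsetSum, aeval_padePoly, Finset.mul_sum]
    refine Finset.sum_congr rfl fun j _ => ?_
    rw [eval_sumIDeriv_C_mul_X_sub_C_pow]
    ring
  rw [hleft, hzero, hone] at h
  rw [h]
  ring

/-- The polynomial `padePoly n n` and its reflection have no common zero except possibly `0`:
they solve, up to exponential factors, the same second order differential equation, and their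
Wronskian is a multiple of `X ^ (2 n)`. -/
theorem eq_zero_of_aeval_padePoly_eq_zero {n : ℕ} (hn : 1 ≤ n) {z : ℂ}
    (h1 : aeval z (padePoly n n) = 0) (h2 : aeval (-z) (padePoly n n) = 0) : z = 0 := by
  set R : ℤ[X] := padePoly n n with hR
  set S : ℤ[X] := R.comp (-X) with hS
  have hodeR : X * derivative (derivative R) - ((2 * n : ℤ[X]) + X) * derivative R + (n : ℤ[X]) * R = 0 := by
    ext k
    have hk : ((n : ℤ) - k) * R.coeff k = (k + 1) * (2 * n - k) * R.coeff (k + 1) := by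
      rw [hR, coeff_padePoly, coeff_padePoly]
      rcases lt_trichotomy k n with hlt | rfl | hgt
      · have hc := Nat.choose_succ_right_eq n k
        have hf : (n + n - k).factorial = (n + n - k) * (n + n - (k + 1)).factorial := by
          rw [show n + n - k = (n + n - (k + 1)) + 1 by omega, Nat.factorial_succ]
        zify [hlt.le] at hc
        rw [hf]
        push_cast [show k ≤ n + n by omega]
        linear_combination (-((n : ℤ) + n - k) * ((n + n - (k + 1)).factorial : ℤ)) * hc
      · simp
      · rw [Nat.choose_eq_zero_of_lt hgt, Nat.choose_eq_zero_of_lt (by omega)]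
        simp
    have e1 : (X * derivative (derivative R)).coeff k = k * (k + 1) * R.coeff (k + 1) := by
      cases k with
      | zero => simp
      | succ k =>
        rw [coeff_X_mul, coeff_derivative, coeff_derivative]
        push_cast
        ring
    have e2 : (X * derivative R).coeff k = k * R.coeff k := by
      cases k with
      | zero => simp
      | succ k =>
        rw [coeff_X_mul, coeff_derivative]
        push_cast
        ring
    have e3 : ((2 * n : ℤ[X]) * derivative R).coeff k = 2 * n * ((k + 1) * R.coeff (k + 1)) := by
      rw [show (2 * n : ℤ[X]) = C (2 * n : ℤ) by simp, coeff_C_mul, coeff_derivative]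
      ring
    have e4 : ((n : ℤ[X]) * R).coeff k = n * R.coeff k := by
      rw [show (n : ℤ[X]) = C (n : ℤ) by simp, coeff_C_mul]
    rw [coeff_add, coeff_sub, add_mul, coeff_add, e1, e2, e3, e4, coeff_zero]
    linear_combination hk
  have hodeS : X * derivative (derivative S) - ((2 * n : ℤ[X]) - X) * derivative S - (n : ℤ[X]) * S = 0 := by
    have h := congrArg (fun q : ℤ[X] => q.comp (-X)) hodeR
    simp only [sub_comp, add_comp, mul_comp, X_comp, zero_comp, natCast_comp,
      ofNat_comp] at h
    have hd : derivative S = -(derivative R).comp (-X) := by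
      rw [hS, derivative_comp]; simp
    have hdd : derivative (derivative S) = (derivative (derivative R)).comp (-X) := by
      rw [hd, derivative_neg, derivative_comp]; simp
    rw [hdd, hd, hS]
    push_cast at h
    linear_combination -h
  set W : ℤ[X] := S * derivative R - derivative S * R - S * R with hW
  have hWode : X * derivative W = (2 * n : ℤ[X]) * W := by
    rw [hW]
    simp only [derivative_sub, derivative_mul]
    linear_combination S * hodeR - R * hodeS
  have hWcoeff : ∀ k, k ≠ 2 * n → W.coeff k = 0 := by
    intro k hk
    have h := congrArg (fun q : ℤ[X] => q.coeff k) hWode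
    have e1 : (X * derivative W).coeff k = k * W.coeff k := by
      cases k with
      | zero => simp
      | succ k =>
        rw [coeff_X_mul, coeff_derivative]
        push_cast
        ring
    have e2 : ((2 * n : ℤ[X]) * W).coeff k = 2 * n * W.coeff k := by
      rw [show (2 * n : ℤ[X]) = C (2 * n : ℤ) by simp, coeff_C_mul]
    simp only [e1, e2] at h
    have hne : (k : ℤ) - 2 * n ≠ 0 := by
      intro h'
      exact hk (by omega)
    exact (mul_eq_zero.mp (by linear_combination h : ((k : ℤ) - 2 * n) * W.coeff k = 0)).resolve_left
      hne
  have hRdeg : R.natDegree ≤ n := natDegree_padePoly_le n n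
  have hSdeg : S.natDegree ≤ n := by
    rw [hS]
    refine natDegree_comp_le.trans ?_
    rw [natDegree_neg, natDegree_X, mul_one]
    exact hRdeg
  have hWtop : W.coeff (2 * n) ≠ 0 := by
    have e1 : (S * derivative R).coeff (2 * n) = 0 := by
      refine coeff_eq_zero_of_natDegree_lt (lt_of_le_of_lt natDegree_mul_le ?_)
      have := natDegree_derivative_le R
      omega
    have e2 : (derivative S * R).coeff (2 * n) = 0 := by
      refine coeff_eq_zero_of_natDegree_lt (lt_of_le_of_lt natDegree_mul_le ?_)
      have := natDegree_derivative_le S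
      omega
    have hRn : R.coeff n ≠ 0 := by
      rw [hR, coeff_padePoly]
      exact_mod_cast (by simp [Nat.factorial_ne_zero] : n.choose n * (n + n - n).factorial ≠ 0)
    have hSn : S.coeff n = (-1) ^ n * R.coeff n := by
      rw [hS, show (-X : ℤ[X]) = C (-1) * X by simp, comp_C_mul_X_coeff, mul_comm]
    have e3 : (S * R).coeff (2 * n) ≠ 0 := by
      rw [two_mul, coeff_mul_add_eq_of_natDegree_le hSdeg hRdeg, hSn]
      exact mul_ne_zero (mul_ne_zero (pow_ne_zero _ (by norm_num)) hRn) hRn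
    rw [hW, coeff_sub, coeff_sub, e1, e2, sub_zero, zero_sub]
    exact neg_ne_zero.mpr e3
  have hWeq : W = C (W.coeff (2 * n)) * X ^ (2 * n) := by
    ext k
    rw [coeff_C_mul_X_pow]
    split_ifs with h
    · rw [h]
    · exact hWcoeff k h
  have hSz : aeval z S = 0 := by
    rw [hS, aeval_comp]
    simpa using h2
  have hWz : aeval z W = 0 := by
    rw [hW, map_sub, map_sub, map_mul, map_mul, map_mul, h1, hSz]
    ring
  rw [hWeq, map_mul, aeval_C, map_pow, aeval_X] at hWz
  have hc : algebraMap ℤ ℂ (W.coeff (2 * n)) ≠ 0 := by simpa using hWtop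
  exact eq_zero_of_pow_eq_zero ((mul_eq_zero.mp hWz).resolve_left hc)

/-! ### The characteristic function under the coefficient conditions -/

theorem sum_mul_sub_pow (N : ℕ) (c : ℕ → ℂ) (s s₀ : ℂ) :
    ∑ j ∈ Finset.range N, c j * (s - s₀) ^ j
      = ∑ k ∈ Finset.range N,
          (∑ j ∈ Finset.Ico k N, c j * ((j.choose k : ℂ) * (-s₀) ^ (j - k))) * s ^ k := by
  simp only [sub_eq_add_neg, add_pow, Finset.mul_sum, Finset.sum_mul]
  rw [Finset.sum_comm' (t' := Finset.range N) (s' := fun k => Finset.Ico k N)]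
  · refine Finset.sum_congr rfl fun k _ => Finset.sum_congr rfl fun j _ => ?_
    ring
  · intro j k
    simp only [Finset.mem_range, Finset.mem_Ico]
    omega

/-- After the substitution `z = τ (s - s₀)`, a characteristic function with the given coefficients
is a constant multiple of the error of Padé approximation of the exponential function. -/
theorem charFun_eq {n m : ℕ} (hn : 1 ≤ n) (hmn : m ≤ n) {a α : ℕ → ℝ} {τ : ℝ} (hτ : 0 < τ)
    {s₀ : ℝ} (hcoeffs : MaxMultCoeffs n m a α τ s₀) (s : ℂ) :
    charFun n m a α τ s = (-1) ^ n / ((m.factorial : ℂ) * (τ : ℂ) ^ n) *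
      (aeval (-(τ * (s - s₀))) (padePoly m n)
        - Complex.exp (-(τ * (s - s₀))) * aeval (τ * (s - s₀)) (padePoly n m)) := by
  obtain ⟨ha, hα⟩ := hcoeffs
  have hτ' : (τ : ℂ) ≠ 0 := Complex.ofReal_ne_zero.mpr hτ.ne'
  have hm' : (m.factorial : ℂ) ≠ 0 := Nat.cast_ne_zero.mpr m.factorial_ne_zero
  have hpoly : s ^ n + ∑ k ∈ Finset.range n, (a k : ℂ) * s ^ k
      = (-1) ^ n / ((m.factorial : ℂ) * (τ : ℂ) ^ n) * aeval (-(τ * (s - s₀))) (padePoly m n) := by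
    set c : ℕ → ℂ := fun j => (-1) ^ (n - j) * (n.choose j : ℂ) * ((m + n - j).factorial : ℂ)
      / ((m.factorial : ℂ) * (τ : ℂ) ^ (n - j)) with hc
    have hcn : c n = 1 := by simp [hc, hm']
    have hright : (-1) ^ n / ((m.factorial : ℂ) * (τ : ℂ) ^ n) *
          aeval (-(τ * (s - s₀))) (padePoly m n)
        = ∑ j ∈ Finset.range (n + 1), c j * (s - s₀) ^ j := by
      rw [aeval_padePoly, Finset.mul_sum]
      refine Finset.sum_congr rfl fun j hj => ?_
      have hj' : j ≤ n := Nat.lt_succ_iff.mp (Finset.mem_range.mp hj)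
      have hsign : (-1 : ℂ) ^ (n - j) = (-1) ^ n * (-1) ^ j := by
        rw [← pow_add, ← Nat.sub_add_cancel hj', Nat.add_sub_cancel, add_assoc, ← two_mul,
          pow_add, pow_mul]
        simp
      have hτn : (τ : ℂ) ^ n = (τ : ℂ) ^ (n - j) * (τ : ℂ) ^ j := by
        rw [← pow_add, Nat.sub_add_cancel hj']
      simp only [hc]
      rw [hsign, hτn, neg_pow (τ * (s - s₀) : ℂ), mul_pow]
      field_simp
    rw [hright, sum_mul_sub_pow, Finset.sum_range_succ, Nat.Ico_succ_singleton,
      Finset.sum_singleton, hcn, add_comm]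
    congr 1
    · refine Finset.sum_congr rfl fun k hk => ?_
      have hk' : k < n := Finset.mem_range.mp hk
      rw [Finset.sum_Ico_succ_top hk'.le, hcn, ha k hk', add_comm (Finset.sum _ _)]
      congr 1
      push_cast
      rw [one_mul, Finset.mul_sum]
      congr 1
      refine Finset.sum_congr rfl fun j hj => ?_
      obtain ⟨hkj, hjn⟩ := Finset.mem_Ico.mp hj
      have hsign : (-1 : ℂ) ^ (n - k) = (-1) ^ (n - j) * (-1) ^ (j - k) := by
        rw [← pow_add]
        congr 1
        omega
      simp only [hc]
      rw [hsign, neg_pow (s₀ : ℂ), Nat.cast_choose ℂ hjn.le,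
        Nat.cast_choose ℂ (show m ≤ m + n - j by omega), show m + n - j - m = n - j by omega]
      have h1 : (j.factorial : ℂ) ≠ 0 := Nat.cast_ne_zero.mpr j.factorial_ne_zero
      have h2 : ((n - j).factorial : ℂ) ≠ 0 := Nat.cast_ne_zero.mpr (n - j).factorial_ne_zero
      field_simp
    · simp
  have hexp : Complex.exp (-s * τ) * ∑ k ∈ Finset.range (m + 1), (α k : ℂ) * s ^ k
      = -((-1) ^ n / ((m.factorial : ℂ) * (τ : ℂ) ^ n) *
        (Complex.exp (-(τ * (s - s₀))) * aeval (τ * (s - s₀)) (padePoly n m))) := by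
    set d : ℕ → ℂ := fun j => (m.choose j : ℂ) * ((m + n - j).factorial : ℂ)
      / ((m.factorial : ℂ) * (τ : ℂ) ^ (n - j)) with hd
    have hright : aeval (τ * (s - s₀)) (padePoly n m)
        = (m.factorial : ℂ) * (τ : ℂ) ^ n * ∑ j ∈ Finset.range (m + 1), d j * (s - s₀) ^ j := by
      rw [aeval_padePoly, Finset.mul_sum]
      refine Finset.sum_congr rfl fun j hj => ?_
      have hj' : j ≤ n := (Nat.lt_succ_iff.mp (Finset.mem_range.mp hj)).trans hmn
      have hτn : (τ : ℂ) ^ n = (τ : ℂ) ^ (n - j) * (τ : ℂ) ^ j := by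
        rw [← pow_add, Nat.sub_add_cancel hj']
      simp only [hd]
      rw [hτn, mul_pow, add_comm n m]
      field_simp
    have hleft : ∑ k ∈ Finset.range (m + 1), (α k : ℂ) * s ^ k
        = (-1) ^ (n - 1) * Complex.exp (s₀ * τ)
          * ∑ j ∈ Finset.range (m + 1), d j * (s - s₀) ^ j := by
      rw [sum_mul_sub_pow, Finset.mul_sum]
      refine Finset.sum_congr rfl fun k hk => ?_
      have hk' : k ≤ m := Nat.lt_succ_iff.mp (Finset.mem_range.mp hk)
      rw [hα k hk', ← mul_assoc]
      congr 1
      push_cast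
      congr 1
      refine Finset.sum_congr (by ext j; simp) fun j hj => ?_
      obtain ⟨hkj, hjm⟩ := Finset.mem_Ico.mp hj
      have hjm' : j ≤ m := Nat.lt_succ_iff.mp hjm
      simp only [hd]
      rw [neg_pow (s₀ : ℂ), Nat.cast_choose ℂ hjm', Nat.cast_choose ℂ hkj]
      have h1 : (j.factorial : ℂ) ≠ 0 := Nat.cast_ne_zero.mpr j.factorial_ne_zero
      have h2 : ((m - j).factorial : ℂ) ≠ 0 := Nat.cast_ne_zero.mpr (m - j).factorial_ne_zero
      have h3 : (k.factorial : ℂ) ≠ 0 := Nat.cast_ne_zero.mpr k.factorial_ne_zero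
      have h4 : ((j - k).factorial : ℂ) ≠ 0 := Nat.cast_ne_zero.mpr (j - k).factorial_ne_zero
      field_simp
    have hE : Complex.exp (-(τ * (s - s₀))) = Complex.exp (-s * τ) * Complex.exp (s₀ * τ) := by
      rw [← Complex.exp_add]
      congr 1
      ring
    have hsign : (-1 : ℂ) ^ n = -(-1) ^ (n - 1) := by
      conv_lhs => rw [← Nat.sub_add_cancel hn, pow_succ]
      ring
    rw [hleft, hright, hE, hsign]
    field_simp
  rw [charFun, hpoly, hexp]
  ring

/-! ### The imaginary axis in the neutral case -/

theorem sum_range_eq_sum_even_add_sum_odd (f : ℕ → ℂ) (n : ℕ) :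
    ∑ j ∈ Finset.range (n + 1), f j
      = ∑ l ∈ Finset.range (n / 2 + 1), f (2 * l)
        + ∑ l ∈ Finset.range ((n + 1) / 2), f (2 * l + 1) := by
  induction n with
  | zero => simp
  | succ n ih =>
    rw [Finset.sum_range_succ, ih]
    rcases Nat.even_or_odd' n with ⟨l, rfl | rfl⟩
    · rw [show 2 * l / 2 = l by omega, show (2 * l + 1) / 2 = l by omega,
        show (2 * l + 1 + 1) / 2 = l + 1 by omega, Finset.sum_range_succ (fun l => f (2 * l + 1))]
      ring
    · rw [show (2 * l + 1) / 2 = l by omega, show (2 * l + 1 + 1) / 2 = l + 1 by omega,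
        show (2 * l + 1 + 1 + 1) / 2 = l + 1 by omega, Finset.sum_range_succ _ (l + 1),
        show 2 * (l + 1) = 2 * l + 1 + 1 by ring]
      ring

theorem xiNum_neg (n : ℕ) (ζ : ℝ) : xiNum n (-ζ) = -xiNum n ζ := by
  simp [xiNum, pow_mul]

theorem xiDen_neg (n : ℕ) (ζ : ℝ) : xiDen n (-ζ) = xiDen n ζ := by
  simp [xiDen, pow_mul]

/-- On the imaginary axis, `xiDen n` and `xiNum n` are the real and the imaginary part of
`padePoly n n`, up to the factor `n!`. -/
theorem aeval_I_mul_padePoly {n : ℕ} (hn : 1 ≤ n) (ζ : ℝ) :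
    aeval (Complex.I * ζ) (padePoly n n)
      = (n.factorial : ℂ) * ((xiDen n ζ : ℂ) + Complex.I * (xiNum n ζ : ℂ)) := by
  rw [aeval_padePoly, sum_range_eq_sum_even_add_sum_odd, show (n + 1) / 2 = (n - 1) / 2 + 1 by omega,
    mul_add]
  have hcoeff : ∀ j, j ≤ n → (n.choose j : ℂ) * ((n + n - j).factorial : ℂ)
      = n.factorial * (((2 * n - j).factorial : ℂ)
          / ((j.factorial : ℂ) * ((n - j).factorial : ℂ))) := fun j hj => by
    rw [Nat.cast_choose ℂ hj, two_mul]
    ring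
  have hI : ∀ l : ℕ, Complex.I ^ (2 * l) = (-1) ^ l := fun l => by
    rw [pow_mul, Complex.I_sq]
  congr 1
  · rw [xiDen, Complex.ofReal_sum, Finset.mul_sum]
    refine Finset.sum_congr rfl fun l hl => ?_
    have hl' := Finset.mem_range.mp hl
    rw [hcoeff _ (by omega), mul_pow, hI]
    push_cast
    ring
  · rw [xiNum, Complex.ofReal_mul, Complex.ofReal_sum, Finset.mul_sum, Finset.mul_sum,
      Finset.mul_sum]
    refine Finset.sum_congr rfl fun l hl => ?_
    have hl' := Finset.mem_range.mp hl
    rw [hcoeff _ (by omega), mul_pow, pow_succ, hI, ← Nat.sub_sub, ← Nat.sub_sub]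
    push_cast
    ring

/-- Multiplied by `e ^ (i ζ / 2)`, the Padé error at `i ζ` becomes a difference of two conjugate
complex numbers, so that its vanishing is a single real equation. -/
theorem pade_error_I_mul_eq_zero_iff {n : ℕ} (hn : 1 ≤ n) (ζ : ℝ) :
    aeval (-(Complex.I * ζ)) (padePoly n n)
        - Complex.exp (-(Complex.I * ζ)) * aeval (Complex.I * ζ) (padePoly n n) = 0 ↔
      Real.sin (ζ / 2) * xiDen n ζ = Real.cos (ζ / 2) * xiNum n ζ := by
  have hE : ∀ x : ℝ, Complex.exp (Complex.I * (x / 2 : ℝ))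
      = (Real.cos (x / 2) : ℂ) + (Real.sin (x / 2) : ℂ) * Complex.I := fun x => by
    rw [mul_comm, Complex.exp_mul_I, Complex.ofReal_cos, Complex.ofReal_sin]
  have h1 : Complex.exp (-(Complex.I * ζ))
      = Complex.exp (Complex.I * (-ζ / 2 : ℝ)) * Complex.exp (Complex.I * (-ζ / 2 : ℝ)) := by
    rw [← Complex.exp_add]
    congr 1
    push_cast
    ring
  have h2 : Complex.exp (Complex.I * (ζ / 2 : ℝ)) * Complex.exp (Complex.I * (-ζ / 2 : ℝ)) = 1 := by
    rw [← Complex.exp_add, ← Complex.exp_zero]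
    congr 1
    push_cast
    ring
  have hfac : (n.factorial : ℂ) ≠ 0 := Nat.cast_ne_zero.mpr n.factorial_ne_zero
  have hneg : -(Complex.I * ζ) = Complex.I * ((-ζ : ℝ) : ℂ) := by push_cast; ring
  have key : Complex.exp (Complex.I * (ζ / 2 : ℝ)) *
      (aeval (-(Complex.I * ζ)) (padePoly n n)
        - Complex.exp (-(Complex.I * ζ)) * aeval (Complex.I * ζ) (padePoly n n))
      = 2 * Complex.I * n.factorial *
        ((Real.sin (ζ / 2) * xiDen n ζ - Real.cos (ζ / 2) * xiNum n ζ : ℝ) : ℂ) := by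
    rw [mul_sub, h1, mul_assoc (Complex.exp _) (Complex.exp _), ← mul_assoc (Complex.exp _), h2,
      one_mul, hE ζ, hE (-ζ), hneg, aeval_I_mul_padePoly hn, aeval_I_mul_padePoly hn, xiNum_neg,
      xiDen_neg, neg_div, Real.cos_neg, Real.sin_neg]
    push_cast
    ring
  constructor
  · intro h
    rw [h, mul_zero] at key
    have h3 := (mul_eq_zero.mp key.symm).resolve_left
      (mul_ne_zero (mul_ne_zero two_ne_zero Complex.I_ne_zero) hfac)
    exact sub_eq_zero.mp (Complex.ofReal_eq_zero.mp h3)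
  · intro h
    rw [h, sub_self, Complex.ofReal_zero, mul_zero] at key
    exact (mul_eq_zero.mp key).resolve_left (Complex.exp_ne_zero _)

/-- A real zero of `xiDen n` is an algebraic number, and hence not an odd multiple of `π`. -/
theorem cos_ne_zero_of_xiDen_eq_zero {n : ℕ} (hn : 1 ≤ n) {ζ : ℝ} (h : xiDen n ζ = 0) :
    Real.cos (ζ / 2) ≠ 0 := by
  intro hcos
  have hneg : -(Complex.I * ζ) = Complex.I * ((-ζ : ℝ) : ℂ) := by push_cast; ring
  set q : ℤ[X] := padePoly n n + (padePoly n n).comp (-X) with hq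
  have hqz : aeval (Complex.I * ζ) q = 0 := by
    rw [hq, map_add, aeval_comp, map_neg, aeval_X, hneg, aeval_I_mul_padePoly hn,
      aeval_I_mul_padePoly hn, xiNum_neg, xiDen_neg, h]
    push_cast
    ring
  have hq0 : q ≠ 0 := by
    intro h0
    have h1 := congrArg (eval 0) h0
    rw [hq, eval_add, eval_comp, eval_neg, eval_X, neg_zero, ← coeff_zero_eq_eval_zero,
      coeff_padePoly, eval_zero] at h1
    have h2 := Nat.factorial_pos (n + n - 0)
    simp only [Nat.choose_zero_right, one_mul] at h1
    omega
  have halg : IsAlgebraic ℚ (Complex.I * ζ) :=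
    (IsFractionRing.isAlgebraic_iff ℤ ℚ ℂ).mp ⟨q, hq0, hqz⟩
  refine exp_ne_neg_one_of_isAlgebraic halg ?_
  have h1 : Complex.exp (Complex.I * ζ) = (Real.cos ζ : ℂ) + (Real.sin ζ : ℂ) * Complex.I := by
    rw [mul_comm, Complex.exp_mul_I, Complex.ofReal_cos, Complex.ofReal_sin]
  have h2 : Real.cos ζ = 2 * Real.cos (ζ / 2) ^ 2 - 1 := by
    rw [← Real.cos_two_mul]; congr 1; ring
  have h3 : Real.sin ζ = 2 * Real.sin (ζ / 2) * Real.cos (ζ / 2) := by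
    rw [← Real.sin_two_mul]; congr 1; ring
  rw [h1, h2, h3, hcos]
  norm_num

/-- Clearing denominators in the equation that defines `Xi n` does not add solutions. -/
theorem mem_Xi_iff {n : ℕ} (hn : 1 ≤ n) (ζ : ℝ) :
    ζ ∈ Xi n ↔ Real.sin (ζ / 2) * xiDen n ζ = Real.cos (ζ / 2) * xiNum n ζ := by
  rw [Xi, Set.mem_ofPred_eq]
  constructor
  · rintro ⟨hcos, hden, h⟩
    rw [Real.tan_eq_sin_div_cos, div_eq_div_iff hcos hden] at h
    linarith
  · intro h
    have hden : xiDen n ζ ≠ 0 := by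
      intro hden
      have hnum : xiNum n ζ = 0 := by
        rw [hden, mul_zero] at h
        exact (mul_eq_zero.mp h.symm).resolve_left (cos_ne_zero_of_xiDen_eq_zero hn hden)
      have hneg : -(Complex.I * ζ) = Complex.I * ((-ζ : ℝ) : ℂ) := by push_cast; ring
      have hζ : Complex.I * ζ = 0 := by
        apply eq_zero_of_aeval_padePoly_eq_zero hn
        · rw [aeval_I_mul_padePoly hn, hden, hnum]; simp
        · rw [hneg, aeval_I_mul_padePoly hn, xiNum_neg, xiDen_neg, hden, hnum]; simp
      -- `padePoly n n` does not vanish at `0` either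
      have h0 := aeval_I_mul_padePoly hn ζ
      rw [hden, hnum, hζ, ← coeff_zero_eq_aeval_zero', coeff_padePoly] at h0
      simp [Nat.factorial_ne_zero] at h0
    have hcos : Real.cos (ζ / 2) ≠ 0 := by
      intro hcos
      rw [hcos, zero_mul] at h
      have hsin : Real.sin (ζ / 2) = 0 := (mul_eq_zero.mp h).resolve_right hden
      have h1 := Real.sin_sq_add_cos_sq (ζ / 2)
      rw [hsin, hcos] at h1
      norm_num at h1
    refine ⟨hcos, hden, ?_⟩
    rw [Real.tan_eq_sin_div_cos, div_eq_div_iff hcos hden]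
    linarith

/-! ### The location of the roots -/

theorem charFun_self {n m : ℕ} (hn : 1 ≤ n) (hmn : m ≤ n) {a α : ℕ → ℝ} {τ : ℝ} (hτ : 0 < τ)
    {s₀ : ℝ} (hcoeffs : MaxMultCoeffs n m a α τ s₀) : charFun n m a α τ s₀ = 0 := by
  have h := pow_mul_betaLaplace m n 0
  rw [zero_pow (Nat.succ_ne_zero _), zero_mul] at h
  have h' := (mul_eq_zero.mp h.symm).resolve_left (pow_ne_zero n (neg_ne_zero.mpr one_ne_zero))
  rw [charFun_eq hn hmn hτ hcoeffs, sub_self, mul_zero, h', mul_zero]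

theorem betaLaplace_eq_zero_of_charFun_eq_zero {n m : ℕ} (hn : 1 ≤ n) (hmn : m ≤ n)
    {a α : ℕ → ℝ} {τ : ℝ} (hτ : 0 < τ) {s₀ : ℝ} (hcoeffs : MaxMultCoeffs n m a α τ s₀) {s : ℂ}
    (hne : s ≠ s₀) (hs : charFun n m a α τ s = 0) : betaLaplace m n (τ * (s - s₀)) = 0 := by
  have hτ' : (τ : ℂ) ≠ 0 := Complex.ofReal_ne_zero.mpr hτ.ne'
  have hm' : (m.factorial : ℂ) ≠ 0 := Nat.cast_ne_zero.mpr m.factorial_ne_zero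
  rw [charFun_eq hn hmn hτ hcoeffs] at hs
  have h1 := (mul_eq_zero.mp hs).resolve_left (div_ne_zero
    (pow_ne_zero n (neg_ne_zero.mpr one_ne_zero)) (mul_ne_zero hm' (pow_ne_zero n hτ')))
  have h2 := pow_mul_betaLaplace m n (τ * (s - s₀))
  rw [h1, mul_zero] at h2
  exact (mul_eq_zero.mp h2).resolve_left
    (pow_ne_zero _ (mul_ne_zero hτ' (sub_ne_zero.mpr hne)))

theorem charFun_add_I_mul_eq_zero_iff {n : ℕ} (hn : 1 ≤ n) {a α : ℕ → ℝ} {τ : ℝ} (hτ : 0 < τ)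
    {s₀ : ℝ} (hcoeffs : MaxMultCoeffs n n a α τ s₀) (ζ : ℝ) :
    charFun n n a α τ (s₀ + Complex.I * (ζ / τ)) = 0 ↔ ζ ∈ Xi n := by
  have hτ' : (τ : ℂ) ≠ 0 := Complex.ofReal_ne_zero.mpr hτ.ne'
  have hn' : (n.factorial : ℂ) ≠ 0 := Nat.cast_ne_zero.mpr n.factorial_ne_zero
  have hz : (τ : ℂ) * (s₀ + Complex.I * (ζ / τ) - s₀) = Complex.I * ζ := by
    field_simp
    ring
  rw [charFun_eq hn le_rfl hτ hcoeffs, hz, mem_Xi_iff hn, ← pade_error_I_mul_eq_zero_iff hn,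
    mul_eq_zero, or_iff_right (div_ne_zero (pow_ne_zero n (neg_ne_zero.mpr one_ne_zero))
      (mul_ne_zero hn' (pow_ne_zero n hτ')))]

theorem re_eq_of_charFun_eq_zero {n : ℕ} (hn : 1 ≤ n) {a α : ℕ → ℝ} {τ : ℝ} (hτ : 0 < τ)
    {s₀ : ℝ} (hcoeffs : MaxMultCoeffs n n a α τ s₀) {s : ℂ} (hs : charFun n n a α τ s = 0) :
    s.re = s₀ := by
  by_cases hne : s = s₀
  · rw [hne, Complex.ofReal_re]
  · have h := re_eq_zero_of_betaLaplace_self_eq_zero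
      (betaLaplace_eq_zero_of_charFun_eq_zero hn le_rfl hτ hcoeffs hne hs)
    rw [Complex.re_ofReal_mul, Complex.sub_re, Complex.ofReal_re] at h
    exact sub_eq_zero.mp ((mul_eq_zero.mp h).resolve_left hτ.ne')

end DelayQuasipoly

theorem theorem3p2 (n m : ℕ) (hn : 1 ≤ n) (hmn : m ≤ n) (a α : ℕ → ℝ) (τ : ℝ) (hτ : 0 < τ)
    (s₀ : ℝ) (hcoeffs : DelayQuasipoly.MaxMultCoeffs n m a α τ s₀) :
    (m < n →
      DelayQuasipoly.IsStrictlyDominantRoot (DelayQuasipoly.charFun n m a α τ) (s₀ : ℂ)) ∧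
    (m = n →
      DelayQuasipoly.IsDominantRoot (DelayQuasipoly.charFun n m a α τ) (s₀ : ℂ) ∧
      (∀ s : ℂ, DelayQuasipoly.charFun n m a α τ s = 0 → s.re = s₀) ∧
      {s : ℂ | DelayQuasipoly.charFun n m a α τ s = 0} =
        {s : ℂ | ∃ ζ ∈ DelayQuasipoly.Xi n,
          s = (s₀ : ℂ) + Complex.I * ((ζ : ℂ) / (τ : ℂ))}) := by
  refine ⟨fun hlt => ⟨DelayQuasipoly.charFun_self hn hmn hτ hcoeffs, fun s hne hs => ?_⟩, ?_⟩
  · have h := DelayQuasipoly.re_neg_of_betaLaplace_eq_zero hlt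
      (DelayQuasipoly.betaLaplace_eq_zero_of_charFun_eq_zero hn hmn hτ hcoeffs hne hs)
    rw [Complex.re_ofReal_mul, Complex.sub_re, Complex.ofReal_re] at h
    rw [Complex.ofReal_re]
    exact sub_neg.mp ((pos_iff_neg_of_mul_neg h).mp hτ)
  · rintro rfl
    have hre : ∀ s : ℂ, DelayQuasipoly.charFun m m a α τ s = 0 → s.re = s₀ := fun s =>
      DelayQuasipoly.re_eq_of_charFun_eq_zero hn hτ hcoeffs
    refine ⟨⟨DelayQuasipoly.charFun_self hn hmn hτ hcoeffs, fun s _ hs => (hre s hs).le⟩, hre, ?_⟩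
    ext s
    simp only [Set.mem_ofPred_eq]
    constructor
    · intro hs
      have hs' : s = (s₀ : ℂ) + Complex.I * (((τ * s.im : ℝ) : ℂ) / (τ : ℂ)) := by
        have hτ' : (τ : ℂ) ≠ 0 := Complex.ofReal_ne_zero.mpr hτ.ne'
        rw [Complex.ofReal_mul, mul_div_cancel_left₀ _ hτ', ← hre s hs, mul_comm]
        exact (Complex.re_add_im s).symm
      refine ⟨τ * s.im, ?_, hs'⟩
      rw [← DelayQuasipoly.charFun_add_I_mul_eq_zero_iff hn hτ hcoeffs, ← hs']
      exact hs
    · rintro ⟨ζ, hζ, rfl⟩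
      exact (DelayQuasipoly.charFun_add_I_mul_eq_zero_iff hn hτ hcoeffs ζ).mpr hζ
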